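/- Let $\mathfrak g$ be a finite-dimensional simple Lie algebra over $\mathbb C$, with Cartan subalgebra $\mathfrak h$ and triangular decomposition $\mathfrak g=\mathfrak n^+\oplus\mathfrak h\oplus\mathfrak n^-$ with respect to a base of its root system, and let $(\cdot,\cdot)$ be a nondegenerate invariant symmetric bilinear form on $\mathfrak g$. Let $n\ge 2$ and $A_n=\mathbb C[t_1^{\pm1},\dots,t_n^{\pm1}]$, and write $t^m=t_1^{m_1}\cdots t_n^{m_n}$ and $X(m)=X\otimes t^m$ for $m\in\mathbb Z^n$, $X\in\mathfrak g$. Let $\mathcal Z$ be the vector space spanned by symbols $t^mK_i$ ($m\in\mathbb Z^n$, $1\le i\le n$) subject to the relations $\sum_i m_i\,t^mK_i=0$, and put $K_i=t^0K_i$. The toroidal Lie algebra is $\tau=(\mathfrak g\otimes A_n)\oplus\mathcal Z\oplus\bigoplus_{i=1}^n\mathbb C d_i$ with brackets $$[X(r),Y(s)]=[X,Y](r+s)+(X,Y)\sum_i r_i\,t^{r+s}K_i,\quad [d_i,X(r)]=r_iX(r),\quad [d_i,t^mK_j]=m_i\,t^mK_j,\quad [d_i,d_j]=0,$$ and with $\mathcal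 Z$ central in $(\mathfrak g\otimes A_n)\oplus\mathcal Z$. Let $\underline{\mathfrak h}$ be the span of $\mathfrak h\otimes 1$, $K_1,\dots,K_n$, $d_1,\dots,d_n$. For a $\tau$-module $V$ and $\lambda\in\underline{\mathfrak h}^*$ let $V_\lambda=\{v\in V: hv=\lambda(h)v\ \forall h\in\underline{\mathfrak h}\}$; a weight vector is a nonzero element of some $V_\lambda$. The module $V$ is called integrable if $V=\bigoplus_{\lambda\in\underline{\mathfrak h}^*}V_\lambda$ and, for every root $\alpha$ of $\mathfrak g$, every root vector $X_\alpha\in\mathfrak g_\alpha$, every $m\in\mathbb Z^n$ and every $v\in V$, there is an integer $k\ge 0$ with $(X_\alpha\otimes t^m)^kv=0$. **Proposition.** Let $V$ be an irreducible integrable $\tau$-module all of whose weight spaces $V_\lambda$ are finite-dimensional, and suppose that $K_1,\dots,K_n$ act by $0$ on $V$. Then there exists a weight vector $v\in V$ such that $(\mathfrak n^+\otimes A_n)v=0$ or $(\mathfrak n^-\otimes A_n)v=0$. -/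

import Mathlib

open scoped TensorProduct

noncomputable section

namespace ToroidalLie

/-- The algebra `A_n = ℂ[t₁^{±1}, …, t_n^{±1}]`; `t^m` is `AddMonoidAlgebra.single m 1`. -/
abbrev Laurent (n : ℕ) : Type := AddMonoidAlgebra ℂ (Fin n → ℤ)

/-- The monomial `t^m`. -/
abbrev mono {n : ℕ} (m : Fin n → ℤ) : Laurent n := AddMonoidAlgebra.single m 1

/-- The relations `∑ i, m i • t^m K_i`, `m ∈ ℤⁿ`, in the free module on the symbols `t^m K_i`. -/
def exactForms (n : ℕ) : Submodule ℂ ((Fin n → ℤ) →₀ (Fin n → ℂ)) :=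
  Submodule.span ℂ (Set.range fun m : Fin n → ℤ => Finsupp.single m fun i => (m i : ℂ))

/-- `𝒵 = Ω_A / dA`: the vector space spanned by the symbols `t^m K_i`
subject to `∑ i, m i • t^m K_i = 0`. -/
abbrev CenterZ (n : ℕ) : Type := ((Fin n → ℤ) →₀ (Fin n → ℂ)) ⧸ exactForms n

/-- The class of `∑ i, w i • t^m K_i`. -/
def zmk {n : ℕ} (m : Fin n → ℤ) : (Fin n → ℂ) →ₗ[ℂ] CenterZ n :=
  (exactForms n).mkQ ∘ₗ Finsupp.lsingle m

lemma zmk_self {n : ℕ} (m : Fin n → ℤ) : zmk m (fun i => (m i : ℂ)) = 0 :=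
  (Submodule.Quotient.mk_eq_zero _).2 (Submodule.subset_span ⟨m, rfl⟩)

/-- The derivation `d_a = ∑ i, a i • d_i` on Laurent polynomials, where `d_i t^m = m i • t^m`. -/
def derA (n : ℕ) : (Fin n → ℂ) →ₗ[ℂ] Laurent n →ₗ[ℂ] Laurent n :=
  Fintype.linearCombination ℂ fun i =>
    (AddMonoidAlgebra.basis (Fin n → ℤ) ℂ).constr ℂ fun m => (m i : ℂ) • mono m

/-- The action of `d_i` on the free module: `t^m K_j ↦ m i • t^m K_j`. -/
def derFree {n : ℕ} (i : Fin n) :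
    ((Fin n → ℤ) →₀ (Fin n → ℂ)) →ₗ[ℂ] ((Fin n → ℤ) →₀ (Fin n → ℂ)) :=
  Finsupp.lsum ℂ fun m => (m i : ℂ) • Finsupp.lsingle m

lemma derFree_exact {n : ℕ} (i : Fin n) :
    exactForms n ≤ (exactForms n).comap (derFree i) := by
  refine Submodule.span_le.2 ?_
  rintro _ ⟨m, rfl⟩
  have h : derFree i (Finsupp.single m fun i => (m i : ℂ)) =
      (m i : ℂ) • Finsupp.single m (fun i => (m i : ℂ)) := by
    simp [derFree]
  change derFree i _ ∈ exactForms n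
  rw [h]
  exact Submodule.smul_mem _ _ (Submodule.subset_span ⟨m, rfl⟩)

/-- The action of `d_a = ∑ i, a i • d_i` on `𝒵`, where `d_i (t^m K_j) = m i • t^m K_j`. -/
def derZ (n : ℕ) : (Fin n → ℂ) →ₗ[ℂ] CenterZ n →ₗ[ℂ] CenterZ n :=
  Fintype.linearCombination ℂ fun i => (exactForms n).mapQ _ (derFree i) (derFree_exact i)

/-- The scalar by which `d_a` acts in degree `m`. -/
def deg {n : ℕ} (a : Fin n → ℂ) (m : Fin n → ℤ) : ℂ := ∑ i, a i * (m i : ℂ)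

lemma deg_add {n : ℕ} (a : Fin n → ℂ) (r s : Fin n → ℤ) :
    deg a (r + s) = deg a r + deg a s := by
  simp [deg, mul_add, Finset.sum_add_distrib]

lemma derA_mono {n : ℕ} (a : Fin n → ℂ) (m : Fin n → ℤ) :
    derA n a (mono m) = deg a m • mono m := by
  have h (i : Fin n) : (AddMonoidAlgebra.basis (Fin n → ℤ) ℂ).constr ℂ
      (fun m => (m i : ℂ) • mono m) (mono m) = (m i : ℂ) • mono m := by
    rw [show (mono m : Laurent n) = AddMonoidAlgebra.basis (Fin n → ℤ) ℂ m from rfl,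
      Module.Basis.constr_basis]
    rfl
  simp only [derA, Fintype.linearCombination_apply, LinearMap.sum_apply, LinearMap.smul_apply, h,
    deg, Finset.sum_smul, smul_smul]

lemma derZ_zmk {n : ℕ} (a : Fin n → ℂ) (m : Fin n → ℤ) (w : Fin n → ℂ) :
    derZ n a (zmk m w) = deg a m • zmk m w := by
  have h (i : Fin n) : (exactForms n).mapQ _ (derFree i) (derFree_exact i) (zmk m w) =
      (m i : ℂ) • zmk m w := by
    rw [zmk, LinearMap.comp_apply, Submodule.mkQ_apply, Submodule.mapQ_apply,
      ← Submodule.Quotient.mk_smul]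
    simp [derFree]
  simp [derZ, Fintype.linearCombination_apply, h, deg, Finset.sum_smul, smul_smul]

/-- The bilinear map `(f, g) ↦ (df) g mod dA`, i.e. `(t^r, t^s) ↦ ∑ i, r i • t^{r+s} K_i`. -/
def omega (n : ℕ) : Laurent n →ₗ[ℂ] Laurent n →ₗ[ℂ] CenterZ n :=
  (AddMonoidAlgebra.basis (Fin n → ℤ) ℂ).constr ℂ fun r =>
    (AddMonoidAlgebra.basis (Fin n → ℤ) ℂ).constr ℂ fun s => zmk (r + s) fun i => (r i : ℂ)

lemma omega_mono {n : ℕ} (r s : Fin n → ℤ) :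
    omega n (mono r) (mono s) = zmk (r + s) fun i => (r i : ℂ) := by
  rw [mono, mono, ← AddMonoidAlgebra.basis_apply, ← AddMonoidAlgebra.basis_apply, omega,
    Module.Basis.constr_basis, Module.Basis.constr_basis]

variable {𝔤 : Type*} [LieRing 𝔤] [LieAlgebra ℂ 𝔤]

variable (𝔤) in
/-- A nondegenerate invariant symmetric bilinear form on `𝔤`. -/
structure InvForm where
  form : LinearMap.BilinForm ℂ 𝔤
  symm : ∀ x y, form x y = form y x
  invariant : ∀ x y z, form ⁅x, y⁆ z = form x ⁅y, z⁆
  nondegenerate : form.Nondegenerate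

/-- The Lie algebra `𝔤_A = 𝔤 ⊗ A` with bracket `[X ⊗ f, Y ⊗ g] = [X, Y] ⊗ f g`,
realised with the tensor factors in the order `A ⊗ 𝔤`. -/
def Loop (n : ℕ) (𝔤 : Type*) [LieRing 𝔤] [LieAlgebra ℂ 𝔤] : Type _ := Laurent n ⊗[ℂ] 𝔤

instance (n : ℕ) : LieRing (Loop n 𝔤) := inferInstanceAs (LieRing (Laurent n ⊗[ℂ] 𝔤))

instance (n : ℕ) : LieAlgebra ℂ (Loop n 𝔤) :=
  inferInstanceAs (LieAlgebra ℂ (Laurent n ⊗[ℂ] 𝔤))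

/-- `X ⊗ f`, as a bilinear function of `f` and `X`. -/
def ten (n : ℕ) (𝔤 : Type*) [LieRing 𝔤] [LieAlgebra ℂ 𝔤] :
    Laurent n →ₗ[ℂ] 𝔤 →ₗ[ℂ] Loop n 𝔤 :=
  TensorProduct.mk ℂ (Laurent n) 𝔤

lemma ten_lie {n : ℕ} (f g : Laurent n) (X Y : 𝔤) :
    ⁅ten n 𝔤 f X, ten n 𝔤 g Y⁆ = ten n 𝔤 (f * g) ⁅X, Y⁆ := rfl

lemma mono_mul {n : ℕ} (r s : Fin n → ℤ) : (mono r * mono s : Laurent n) = mono (r + s) := by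
  simp

/-- The cocycle `(f ⊗ X, g ⊗ Y) ↦ (X, Y) (df) g` on `𝔤_A`. -/
def cocycle (n : ℕ) (B : InvForm 𝔤) :
    Loop n 𝔤 →ₗ[ℂ] Loop n 𝔤 →ₗ[ℂ] CenterZ n :=
  TensorProduct.curry (R := ℂ) (M := Laurent n ⊗[ℂ] 𝔤) (N := Laurent n ⊗[ℂ] 𝔤) <| (TensorProduct.rid ℂ (CenterZ n)).toLinearMap ∘ₗ
    TensorProduct.map (TensorProduct.lift (omega n)) (TensorProduct.lift B.form) ∘ₗ
      (TensorProduct.tensorTensorTensorComm ℂ (Laurent n) 𝔤 (Laurent n) 𝔤).toLinearMap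

lemma cocycle_ten {n : ℕ} (B : InvForm 𝔤) (f g : Laurent n) (X Y : 𝔤) :
    cocycle n B (ten n 𝔤 f X) (ten n 𝔤 g Y) = B.form X Y • omega n f g := by
  change (TensorProduct.rid ℂ (CenterZ n)) (omega n f g ⊗ₜ B.form X Y) = _
  simp

/-- The action of `d_a` on `𝔤_A`. -/
def derG (n : ℕ) (𝔤 : Type*) [LieRing 𝔤] [LieAlgebra ℂ 𝔤] :
    (Fin n → ℂ) →ₗ[ℂ] Loop n 𝔤 →ₗ[ℂ] Loop n 𝔤 :=
  letI e : (Laurent n ⊗[ℂ] 𝔤 →ₗ[ℂ] Laurent n ⊗[ℂ] 𝔤) →ₗ[ℂ] (Loop n 𝔤 →ₗ[ℂ] Loop n 𝔤) :=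
    LinearMap.id
  e ∘ₗ LinearMap.rTensorHom 𝔤 ∘ₗ derA n

lemma derG_ten {n : ℕ} (a : Fin n → ℂ) (f : Laurent n) (X : 𝔤) :
    derG n 𝔤 a (ten n 𝔤 f X) = ten n 𝔤 (derA n a f) X := rfl

lemma loop_induction {n : ℕ} {p : Loop n 𝔤 → Prop} (x : Loop n 𝔤)
    (zero : p 0) (add : ∀ x y, p x → p y → p (x + y))
    (mono : ∀ (r : Fin n → ℤ) (X : 𝔤), p (ten n 𝔤 (mono r) X)) : p x := by
  refine TensorProduct.induction_on (motive := p) x zero (fun f X => ?_) add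
  induction f using AddMonoidAlgebra.induction_linear with
  | zero => rw [TensorProduct.zero_tmul]; exact zero
  | add f g hf hg => rw [TensorProduct.add_tmul]; exact add _ _ hf hg
  | single m c =>
    have h := mono m (c • X)
    have e : (AddMonoidAlgebra.single m c : Laurent n) = c • ToroidalLie.mono m := by simp
    rw [e, TensorProduct.smul_tmul]
    exact h

lemma cocycle_skew {n : ℕ} (B : InvForm 𝔤) (x y : Loop n 𝔤) :
    cocycle n B x y = -cocycle n B y x := by
  induction x using loop_induction with
  | zero => simp
  | add x x' h h' => simp only [map_add, LinearMap.add_apply, h, h']; abel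
  | mono r X =>
    induction y using loop_induction with
    | zero => simp
    | add x x' h h' => simp only [map_add, LinearMap.add_apply, h, h']; abel
    | mono s Y =>
      have h := zmk_self (r + s)
      have h2 : (fun i => (((r + s) i : ℤ) : ℂ)) = (fun i => (r i : ℂ)) + fun i => (s i : ℂ) := by
        ext i; simp
      rw [h2, map_add] at h
      rw [cocycle_ten, cocycle_ten, omega_mono, omega_mono, B.symm Y X, add_comm s r, ← smul_neg,
        eq_neg_of_add_eq_zero_left h]

lemma cocycle_self {n : ℕ} (B : InvForm 𝔤) (x : Loop n 𝔤) : cocycle n B x x = 0 :=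
  by
  have h := cocycle_skew B x x
  have h2 : (2 : ℂ) • cocycle n B x x = 0 := by
    rw [two_smul]; exact eq_neg_iff_add_eq_zero.1 h
  exact (smul_eq_zero.1 h2).resolve_left two_ne_zero

lemma cocycle_leibniz {n : ℕ} (B : InvForm 𝔤) (x y z : Loop n 𝔤) :
    cocycle n B x ⁅y, z⁆ = cocycle n B ⁅x, y⁆ z + cocycle n B y ⁅x, z⁆ := by
  induction x using loop_induction with
  | zero => simp
  | add x x' h h' => simp only [map_add, LinearMap.add_apply, add_lie, h, h']; abel
  | mono r X =>
    induction y using loop_induction with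
    | zero => simp
    | add x x' h h' => simp only [map_add, LinearMap.add_apply, add_lie, lie_add, h, h']; abel
    | mono s Y =>
      induction z using loop_induction with
      | zero => simp
      | add x x' h h' => simp only [map_add, lie_add, h, h']; abel
      | mono t Z =>
        have h1 : B.form Y ⁅X, Z⁆ = -B.form X ⁅Y, Z⁆ := by
          rw [← B.invariant, ← lie_skew, map_neg, LinearMap.neg_apply, B.invariant]
        have e1 : s + (r + t) = r + (s + t) := by abel
        have e2 : r + s + t = r + (s + t) := by abel
        have h2 : (fun i => (((r + s) i : ℤ) : ℂ)) =
            (fun i => (r i : ℂ)) + fun i => (s i : ℂ) := by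
          ext i; simp
        simp only [ten_lie, mono_mul, cocycle_ten, omega_mono, B.invariant, h1, e1, e2, h2, map_add]
        module

lemma derG_lie {n : ℕ} (a : Fin n → ℂ) (x y : Loop n 𝔤) :
    derG n 𝔤 a ⁅x, y⁆ = ⁅derG n 𝔤 a x, y⁆ + ⁅x, derG n 𝔤 a y⁆ := by
  induction x using loop_induction with
  | zero => simp
  | add x x' h h' => simp only [map_add, add_lie, h, h']; abel
  | mono r X =>
    induction y using loop_induction with
    | zero => simp
    | add x x' h h' => simp only [map_add, lie_add, h, h']; abel
    | mono s Y =>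
      simp only [ten_lie, mono_mul, derG_ten, derA_mono, deg_add, map_smul, LinearMap.smul_apply, smul_lie, lie_smul]
      module

lemma derG_comm {n : ℕ} (a b : Fin n → ℂ) (x : Loop n 𝔤) :
    derG n 𝔤 a (derG n 𝔤 b x) = derG n 𝔤 b (derG n 𝔤 a x) := by
  induction x using loop_induction with
  | zero => simp
  | add x x' h h' => simp only [map_add, h, h']
  | mono r X =>
    simp only [derG_ten, derA_mono, map_smul, LinearMap.smul_apply]
    module

lemma derZ_cocycle {n : ℕ} (B : InvForm 𝔤) (a : Fin n → ℂ) (x y : Loop n 𝔤) :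
    derZ n a (cocycle n B x y) = cocycle n B (derG n 𝔤 a x) y + cocycle n B x (derG n 𝔤 a y) := by
  induction x using loop_induction with
  | zero => simp
  | add x x' h h' => simp only [map_add, LinearMap.add_apply, h, h']; abel
  | mono r X =>
    induction y using loop_induction with
    | zero => simp
    | add x x' h h' => simp only [map_add, h, h']; abel
    | mono s Y =>
      simp only [derG_ten, derA_mono, map_smul, LinearMap.smul_apply,
        cocycle_ten, omega_mono, derZ_zmk, deg_add]
      module

lemma derZ_comm {n : ℕ} (a b : Fin n → ℂ) (z : CenterZ n) :
    derZ n a (derZ n b z) = derZ n b (derZ n a z) := by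
  obtain ⟨w, rfl⟩ := Submodule.mkQ_surjective _ z
  induction w using Finsupp.induction_linear with
  | zero => simp
  | add x y h h' => simp only [map_add, h, h']
  | single m w =>
    change derZ n a (derZ n b (zmk m w)) = derZ n b (derZ n a (zmk m w))
    simp only [derZ_zmk, map_smul]
    module

/-- The toroidal Lie algebra `τ = 𝔤_A ⊕ 𝒵 ⊕ D`, where `D` has basis `d_1, …, d_n`. -/
def Toroidal (n : ℕ) (_B : InvForm 𝔤) : Type _ :=
  Loop n 𝔤 × CenterZ n × (Fin n → ℂ)

variable {n : ℕ} {B : InvForm 𝔤}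

instance : AddCommGroup (Toroidal n B) :=
  inferInstanceAs (AddCommGroup (Loop n 𝔤 × CenterZ n × (Fin n → ℂ)))

instance : Module ℂ (Toroidal n B) :=
  inferInstanceAs (Module ℂ (Loop n 𝔤 × CenterZ n × (Fin n → ℂ)))

/-- The bracket with
`[X(r), Y(s)] = [X, Y](r + s) + (X, Y) ∑ i, r i • t^{r+s} K_i`, `𝒵` central in `𝔤_A ⊕ 𝒵`,
`[d_i, X(r)] = r i • X(r)`, `[d_i, t^m K_j] = m i • t^m K_j`, and `[d_i, d_j] = 0`. -/
instance : Bracket (Toroidal n B) (Toroidal n B) where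
  bracket p q :=
    (⁅p.1, q.1⁆ + derG n 𝔤 p.2.2 q.1 - derG n 𝔤 q.2.2 p.1,
      cocycle n B p.1 q.1 + derZ n p.2.2 q.2.1 - derZ n q.2.2 p.2.1, 0)

lemma bracket_def (p q : Toroidal n B) : ⁅p, q⁆ =
    (⁅p.1, q.1⁆ + derG n 𝔤 p.2.2 q.1 - derG n 𝔤 q.2.2 p.1,
      cocycle n B p.1 q.1 + derZ n p.2.2 q.2.1 - derZ n q.2.2 p.2.1, 0) := rfl

instance : LieRing (Toroidal n B) where
  add_lie := by
    rintro ⟨x, z, a⟩ ⟨x', z', a'⟩ ⟨y, w, b⟩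
    refine Prod.ext ?_ (Prod.ext ?_ ?_)
    · change ⁅x + x', y⁆ + derG n 𝔤 (a + a') y - derG n 𝔤 b (x + x') =
        (⁅x, y⁆ + derG n 𝔤 a y - derG n 𝔤 b x) + (⁅x', y⁆ + derG n 𝔤 a' y - derG n 𝔤 b x')
      simp only [add_lie, map_add, LinearMap.add_apply]; abel
    · change cocycle n B (x + x') y + derZ n (a + a') w - derZ n b (z + z') =
        (cocycle n B x y + derZ n a w - derZ n b z) + (cocycle n B x' y + derZ n a' w - derZ n b z')
      simp only [map_add, LinearMap.add_apply]; abel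
    · change (0 : Fin n → ℂ) = 0 + 0
      simp
  lie_add := by
    rintro ⟨y, w, b⟩ ⟨x, z, a⟩ ⟨x', z', a'⟩
    refine Prod.ext ?_ (Prod.ext ?_ ?_)
    · change ⁅y, x + x'⁆ + derG n 𝔤 b (x + x') - derG n 𝔤 (a + a') y =
        (⁅y, x⁆ + derG n 𝔤 b x - derG n 𝔤 a y) + (⁅y, x'⁆ + derG n 𝔤 b x' - derG n 𝔤 a' y)
      simp only [lie_add, map_add, LinearMap.add_apply]; abel
    · change cocycle n B y (x + x') + derZ n b (z + z') - derZ n (a + a') w =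
        (cocycle n B y x + derZ n b z - derZ n a w) + (cocycle n B y x' + derZ n b z' - derZ n a' w)
      simp only [map_add, LinearMap.add_apply]; abel
    · change (0 : Fin n → ℂ) = 0 + 0
      simp
  lie_self := by
    rintro ⟨x, z, a⟩
    refine Prod.ext ?_ (Prod.ext ?_ rfl)
    · change ⁅x, x⁆ + derG n 𝔤 a x - derG n 𝔤 a x = 0
      simp
    · change cocycle n B x x + derZ n a z - derZ n a z = 0
      simp [cocycle_self]
  leibniz_lie := by
    rintro ⟨x, u, a⟩ ⟨y, v, b⟩ ⟨z, w, c⟩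
    refine Prod.ext ?_ (Prod.ext ?_ ?_)
    · change ⁅x, ⁅y, z⁆ + derG n 𝔤 b z - derG n 𝔤 c y⁆ +
          derG n 𝔤 a (⁅y, z⁆ + derG n 𝔤 b z - derG n 𝔤 c y) - derG n 𝔤 0 x =
        (⁅⁅x, y⁆ + derG n 𝔤 a y - derG n 𝔤 b x, z⁆ + derG n 𝔤 0 z -
          derG n 𝔤 c (⁅x, y⁆ + derG n 𝔤 a y - derG n 𝔤 b x)) +
        (⁅y, ⁅x, z⁆ + derG n 𝔤 a z - derG n 𝔤 c x⁆ +
          derG n 𝔤 b (⁅x, z⁆ + derG n 𝔤 a z - derG n 𝔤 c x) - derG n 𝔤 0 y)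
      simp only [lie_add, lie_sub, add_lie, sub_lie, map_add, map_sub, map_zero,
        LinearMap.zero_apply, derG_lie, derG_comm b a, derG_comm c a, derG_comm c b,
        lie_lie x y z, ← lie_skew (derG n 𝔤 c x) y]
      abel
    · change cocycle n B x (⁅y, z⁆ + derG n 𝔤 b z - derG n 𝔤 c y) +
          derZ n a (cocycle n B y z + derZ n b w - derZ n c v) - derZ n 0 u =
        (cocycle n B (⁅x, y⁆ + derG n 𝔤 a y - derG n 𝔤 b x) z + derZ n 0 w -
          derZ n c (cocycle n B x y + derZ n a v - derZ n b u)) +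
        (cocycle n B y (⁅x, z⁆ + derG n 𝔤 a z - derG n 𝔤 c x) +
          derZ n b (cocycle n B x z + derZ n a w - derZ n c u) - derZ n 0 v)
      simp only [map_add, map_sub, map_zero, LinearMap.zero_apply, LinearMap.add_apply,
        LinearMap.sub_apply, derZ_cocycle, derZ_comm b a, derZ_comm c a, derZ_comm c b,
        cocycle_leibniz B x y z, cocycle_skew B y (derG n 𝔤 c x)]
      abel
    · change (0 : Fin n → ℂ) = 0 + 0
      simp

instance : LieAlgebra ℂ (Toroidal n B) where
  lie_smul := by
    rintro t ⟨x, u, a⟩ ⟨y, v, b⟩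
    refine Prod.ext ?_ (Prod.ext ?_ ?_)
    · change ⁅x, t • y⁆ + derG n 𝔤 a (t • y) - derG n 𝔤 (t • b) x =
        t • (⁅x, y⁆ + derG n 𝔤 a y - derG n 𝔤 b x)
      simp only [lie_smul, map_smul, LinearMap.smul_apply]; module
    · change cocycle n B x (t • y) + derZ n a (t • v) - derZ n (t • b) u =
        t • (cocycle n B x y + derZ n a v - derZ n b u)
      simp only [map_smul, LinearMap.smul_apply]; module
    · change (0 : Fin n → ℂ) = t • 0
      simp

variable (n B) in
/-- The element `X ⊗ f` of `𝔤_A ⊆ τ`. -/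
def loop (X : 𝔤) (f : Laurent n) : Toroidal n B := (ten n 𝔤 f X, 0, 0)

variable (B) in
/-- The element `t^m K_i` of `𝒵 ⊆ τ`. -/
def tK (m : Fin n → ℤ) (i : Fin n) : Toroidal n B := (0, zmk m (Pi.single i 1), 0)

variable (B) in
/-- The degree derivation `d_i ∈ D ⊆ τ`. -/
def d (i : Fin n) : Toroidal n B := (0, 0, Pi.single i 1)

variable (n B) in
/-- `h̲`, the span of `h`, `K_1, …, K_n` and `d_1, …, d_n`, for a Cartan subalgebra `h` of `𝔤`. -/
def cartan (H : LieSubalgebra ℂ 𝔤) : Submodule ℂ (Toroidal n B) :=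
  Submodule.span ℂ ((fun X => loop n B X 1) '' (H : Set 𝔤) ∪
    Set.range (tK B (0 : Fin n → ℤ)) ∪ Set.range (d B))

section Modules

variable (H : LieSubalgebra ℂ 𝔤) (V : Type*) [AddCommGroup V] [Module ℂ V]
  [LieRingModule (Toroidal n B) V] [LieModule ℂ (Toroidal n B) V]

/-- `V_μ = {v | x v = μ(x) v for all x ∈ h̲}`. -/
def weightSpace (μ : Module.Dual ℂ (cartan n B H)) : Submodule ℂ V where
  carrier := {v | ∀ x : cartan n B H, ⁅(x : Toroidal n B), v⁆ = μ x • v}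
  add_mem' hv hw x := by rw [lie_add, hv x, hw x, smul_add]
  zero_mem' x := by simp
  smul_mem' c v hv x := by rw [lie_smul, hv x, smul_comm]

variable (n B)

/-- `V` is integrable: it is the direct sum of its weight spaces and all `X_α ⊗ t^m` act locally
nilpotently, for every root `α` of `𝔤` and every root vector `X_α`. -/
structure IsIntegrable [LieRing.IsNilpotent H] : Prop where
  iSupIndep_weightSpace : iSupIndep fun μ : Module.Dual ℂ (cartan n B H) => weightSpace H V μ
  iSup_weightSpace : ⨆ μ : Module.Dual ℂ (cartan n B H), weightSpace H V μ = ⊤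
  locallyNilpotent : ∀ α : LieModule.Weight ℂ H 𝔤, α.IsNonZero →
    ∀ X ∈ LieAlgebra.rootSpace H α, ∀ (m : Fin n → ℤ) (v : V),
      ∃ k : ℕ, (LieModule.toEnd ℂ (Toroidal n B) V (loop n B X (mono m)) ^ k) v = 0

end Modules

section Triangular

variable [FiniteDimensional ℂ 𝔤] [LieAlgebra.IsSimple ℂ 𝔤]
  {H : LieSubalgebra ℂ 𝔤} [H.IsCartanSubalgebra]

/-- `n⁺`, the sum of the root spaces of the positive roots with respect to the base `b`. -/
def nPos (b : (LieAlgebra.IsKilling.rootSystem H).Base) : Submodule ℂ 𝔤 :=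
  ⨆ α : {α // b.IsPos α}, (LieAlgebra.rootSpace H α.1.1).toSubmodule

/-- `n⁻`, the sum of the root spaces of the negative roots with respect to the base `b`. -/
def nNeg (b : (LieAlgebra.IsKilling.rootSystem H).Base) : Submodule ℂ 𝔤 :=
  ⨆ α : {α // b.IsPos α}, (LieAlgebra.rootSpace H (-α.1.1)).toSubmodule

end Triangular

end ToroidalLie

end

/-!
Write a weight of `V` as a pair `(μ, ν)`, with `μ` its restriction to `H` and `ν` its values on the
`d_i` (`bigradedSpace`). Since the `K_i` act by zero, for every root `α` and every `m` the elements
`X_α ⊗ t^m` and `X_{-α} ⊗ t^{-m}` generate an `sl₂` whose Cartan element acts as the coroot `α^∨`.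
Raising a weight vector to a highest weight vector of this `sl₂` and lowering it again shows that if
`(μ, ν)` is a weight and `c ≤ μ(α^∨)`, then `(μ - c α, ν - c m)` is a weight for every `m`
(`bigradedSpace_sub_ne_bot`). The same computation, together with finite-dimensionality of the
weight spaces, shows that `(μ + c α, ν)` is not a weight for large `c`
(`exists_forall_bigradedSpace_add_eq_bot`).

Fix a weight `(μ₀, ν₀)` and consider the weights `(μ₀ + q, ν₀ + m)` with `q` in the root lattice and
`m` integral. Only finitely many `q` occur with `m = 0`: an element of the root lattice is a sum
`∑ c_i β_i` of roots that are pairwise at non-obtuse angles (`RootPairing.exists_acute_sum`), so the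
descent property allows any of the large terms `c_i β_i` to be removed in any order, and each `c_i`
is bounded by the behaviour along a single root direction (`finite_of_string_descent`). Any other
occurring `q` with `μ₀ + q ≠ 0` is moved by one descent step into degree `ν₀`, because `m` may be
chosen freely there. Hence only finitely many `q` occur at all (`finite_weights`). For one of maximal
height, a weight vector is annihilated by every `X_α ⊗ t^m` with `α` positive.
-/

/-! ### Representations of `sl₂` with locally nilpotent action -/

section SlTwo

variable {V : Type*} [AddCommGroup V] [Module ℂ V] {E F D : Module.End ℂ V}

lemma slTwo_raise_lower_succ (hEF : ∀ x, E (F x) = F (E x) + D x)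
    (hDF : ∀ x, D (F x) = F (D x) - (2 : ℂ) • F x) {u : V} {p : ℂ}
    (hE : E u = 0) (hD : D u = p • u) (k : ℕ) :
    E ((F ^ (k + 1)) u) = (((k : ℂ) + 1) * (p - k)) • (F ^ k) u := by
  have hDk (k : ℕ) : D ((F ^ k) u) = (p - 2 * k) • (F ^ k) u := by
    induction k with
    | zero => simp [hD]
    | succ k ih =>
      rw [pow_succ', Module.End.mul_apply, hDF, ih, map_smul]
      push_cast
      module
  induction k with
  | zero => simp [hEF, hE, hD]
  | succ k ih =>
    rw [pow_succ', Module.End.mul_apply, hEF, ih, hDk, map_smul, ← Module.End.mul_apply,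
      ← pow_succ']
    push_cast
    module

lemma slTwo_raise_pow_lower_pow (hEF : ∀ x, E (F x) = F (E x) + D x)
    (hDF : ∀ x, D (F x) = F (D x) - (2 : ℂ) • F x) {u : V} {p : ℂ}
    (hE : E u = 0) (hD : D u = p • u) (k : ℕ) :
    (E ^ k) ((F ^ k) u) = (∏ j ∈ Finset.range k, ((j : ℂ) + 1) * (p - j)) • u := by
  induction k with
  | zero => simp
  | succ k ih =>
    rw [pow_succ E, Module.End.mul_apply, slTwo_raise_lower_succ hEF hDF hE hD, map_smul, ih,
      smul_smul, Finset.prod_range_succ]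
    ring_nf

/-- Raising a weight vector `v` as far as possible gives a highest weight vector `E ^ k v` whose
weight is a natural number `p`, and lowering it by up to `p` steps can be undone. -/
lemma slTwo_exists_highest (hEF : ∀ x, E (F x) = F (E x) + D x)
    (hDF : ∀ x, D (F x) = F (D x) - (2 : ℂ) • F x)
    (hDE : ∀ x, D (E x) = E (D x) + (2 : ℂ) • E x)
    (hEn : ∀ x, ∃ k : ℕ, (E ^ k) x = 0) (hFn : ∀ x, ∃ k : ℕ, (F ^ k) x = 0)
    {v : V} (hv : v ≠ 0) {a : ℂ} (hD : D v = a • v) :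
    ∃ k p : ℕ, a + 2 * k = p ∧ ∀ c ≤ p, (E ^ c) ((F ^ c) ((E ^ k) v)) ≠ 0 := by
  classical
  obtain ⟨k, hk⟩ : ∃ k, Nat.find (hEn v) = k + 1 :=
    Nat.exists_eq_succ_of_ne_zero fun h => hv (by simpa [h] using Nat.find_spec (hEn v))
  have hu0 : (E ^ k) v ≠ 0 := Nat.find_min (hEn v) (by omega)
  have hEu : E ((E ^ k) v) = 0 := by
    rw [← Module.End.mul_apply, ← pow_succ', ← hk]
    exact Nat.find_spec (hEn v)
  have hDu : D ((E ^ k) v) = (a + 2 * k) • (E ^ k) v := by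
    clear hk hu0 hEu
    induction k with
    | zero => simp [hD]
    | succ k ih =>
      rw [pow_succ', Module.End.mul_apply, hDE, ih, map_smul]
      push_cast
      module
  have key := slTwo_raise_pow_lower_pow hEF hDF hEu hDu
  obtain ⟨N, hN⟩ := hFn ((E ^ k) v)
  have h0 := key N
  rw [hN, map_zero, eq_comm, smul_eq_zero, or_iff_left hu0, Finset.prod_eq_zero_iff] at h0
  obtain ⟨p, -, hp⟩ := h0
  have hp' : a + 2 * k = p := by
    rcases mul_eq_zero.1 hp with h | h
    · exact absurd h (by exact_mod_cast p.succ_ne_zero)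
    · exact sub_eq_zero.1 h
  refine ⟨k, p, hp', fun c hc => ?_⟩
  rw [key c, hp']
  refine smul_ne_zero (Finset.prod_ne_zero_iff.2 fun j hj => mul_ne_zero ?_ ?_) hu0
  · exact_mod_cast j.succ_ne_zero
  · rw [sub_ne_zero]
    have := Finset.mem_range.1 hj
    exact_mod_cast (by omega : p ≠ j)

lemma exists_forall_pow_apply_eq_zero (hEn : ∀ x, ∃ k : ℕ, (E ^ k) x = 0) (W : Submodule ℂ V)
    [FiniteDimensional ℂ W] : ∃ N : ℕ, ∀ k ≥ N, ∀ w ∈ W, (E ^ k) w = 0 := by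
  obtain ⟨s, hs⟩ := (Submodule.fg_iff_finiteDimensional W).2 inferInstance
  choose N hN using hEn
  refine ⟨s.sup N, fun k hk w hw => ?_⟩
  have hle : W ≤ LinearMap.ker (E ^ k) := by
    rw [← hs, Submodule.span_le]
    intro x hx
    exact Module.End.pow_map_zero_of_le ((Finset.le_sup (f := N) hx).trans hk) (hN x)
  exact hle hw

end SlTwo

/-! ### Acute decompositions in a root lattice -/

section RootLattice

variable {ι M N : Type*} [AddCommGroup M] [Module ℂ M] [AddCommGroup N] [Module ℂ N]

/-- An expression of `q` as a sum of roots with the least number of summands involves no two roots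
at an obtuse angle, as two such roots could be cancelled or replaced by their sum. -/
lemma RootPairing.exists_acute_sum [Fintype ι] (P : RootPairing ι ℂ M N) [P.IsCrystallographic]
    {q : M} (hq : q ∈ AddSubgroup.closure (Set.range P.root)) :
    ∃ c : ι → ℕ, q = ∑ i, c i • P.root i ∧
      ∀ i j, c i ≠ 0 → c j ≠ 0 → 0 ≤ P.pairingIn ℤ i j := by
  classical
  have hex : ∃ k : ℕ, ∃ c : ι → ℕ, q = ∑ i, c i • P.root i ∧ ∑ i, c i = k := by
    induction hq using AddSubgroup.closure_induction'' with
    | zero => exact ⟨_, 0, by simp, rfl⟩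
    | mem x hx =>
      obtain ⟨i, rfl⟩ := hx
      exact ⟨_, Pi.single i 1, by simp [Pi.single_apply, ite_smul], rfl⟩
    | neg_mem x hx =>
      obtain ⟨i, rfl⟩ := hx
      refine ⟨_, Pi.single (P.reflectionPerm i i) 1, ?_, rfl⟩
      simp [Pi.single_apply, ite_smul]
    | add x y _ _ hx hy =>
      obtain ⟨_, c, hc, -⟩ := hx
      obtain ⟨_, c', hc', -⟩ := hy
      exact ⟨_, c + c', by simp [hc, hc', add_smul, Finset.sum_add_distrib], rfl⟩
  obtain ⟨c, hc, hcard⟩ := Nat.find_spec hex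
  refine ⟨c, hc, fun i j hi hj => ?_⟩
  by_contra! hneg
  have hij : i ≠ j := by
    rintro rfl
    simp at hneg
  obtain ⟨c', hc'⟩ : ∃ c', c = Pi.single i 1 + Pi.single j 1 + c' := by
    refine exists_add_of_le fun l => ?_
    simp only [Pi.add_apply, Pi.single_apply]
    split_ifs with h1 h2 h2 <;> subst_vars <;> first | omega | exact absurd rfl hij
  have hsum : q = P.root i + P.root j + ∑ l, c' l • P.root l := by
    rw [hc, hc']
    simp [add_smul, Finset.sum_add_distrib, Pi.single_apply, ite_smul]
  have hlt : ∑ l, c l = 2 + ∑ l, c' l := by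
    rw [hc']
    simp [Finset.sum_add_distrib]
  by_cases hopp : P.root i = -P.root j
  · exact Nat.find_min hex (m := ∑ l, c' l) (by omega) ⟨c', by simp [hsum, hopp], rfl⟩
  · obtain ⟨k, hk⟩ := P.root_add_root_mem_of_pairingIn_neg hneg hopp
    refine Nat.find_min hex (m := 1 + ∑ l, c' l) (by omega) ⟨Pi.single k 1 + c', ?_, ?_⟩
    · rw [hsum, ← hk]
      simp [add_smul, Finset.sum_add_distrib, Pi.single_apply, ite_smul]
    · simp [Finset.sum_add_distrib]

variable {P : RootPairing ι ℂ M N} [P.IsCrystallographic] {S : Set M}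

/-- If `S` is closed under moving down root strings inside the range allowed by `sl₂`, then the
roots of an acute sum can be stripped off a member of `S` one direction at a time. -/
lemma mem_of_add_acute_sum_mem
    (hS : ∀ (μ : M) (i : ι) (z : ℤ) (c : ℕ), P.toLinearMap μ (P.coroot i) = z → -z ≤ c →
      μ + c • P.root i ∈ S → μ ∈ S)
    {c : ι → ℕ} (hc : ∀ i j, c i ≠ 0 → c j ≠ 0 → 0 ≤ P.pairingIn ℤ i j) (T : Finset ι)
    (hT : ∀ i ∈ T, c i ≠ 0) :
    ∀ (μ : M) (z : ι → ℤ), (∀ i, P.toLinearMap μ (P.coroot i) = z i) → (∀ i ∈ T, -z i ≤ c i) →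
      μ + ∑ i ∈ T, c i • P.root i ∈ S → μ ∈ S := by
  classical
  induction T using Finset.induction_on with
  | empty => simp
  | insert j T hj ih =>
    intro μ z hz hle hmem
    rw [Finset.sum_insert hj, ← add_assoc] at hmem
    refine hS μ j (z j) (c j) (hz j) (hle j (by simp)) <|
      ih (fun i hi => hT i (by simp [hi])) (μ + c j • P.root j)
        (fun i => z i + c j * P.pairingIn ℤ j i) (fun i => ?_) (fun i hi => ?_) hmem
    · have := P.algebraMap_pairingIn ℤ j i
      simp only [algebraMap_int_eq, eq_intCast] at this
      simp [hz, this]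
    · have h1 := hle i (by simp [hi])
      have := mul_nonneg (Nat.cast_nonneg (α := ℤ) (c j))
        (hc j i (hT j (by simp)) (hT i (by simp [hi])))
      linarith

/-- A subset of a coset of the root lattice with the descent property of `sl₂`-strings, and meeting
every ray in a root direction in a bounded set, is finite: writing its members as acute sums, all
but the small coefficients and a given one can be stripped off, so that each coefficient is bounded
by the finitely many rays issuing from points with small coefficients. -/
lemma finite_of_string_descent [Fintype ι]
    (hS : ∀ (μ : M) (i : ι) (z : ℤ) (c : ℕ), P.toLinearMap μ (P.coroot i) = z → -z ≤ c →
      μ + c • P.root i ∈ S → μ ∈ S)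
    (hbd : ∀ (μ : M) (i : ι) (z : ℤ), P.toLinearMap μ (P.coroot i) = z →
      ∃ k : ℕ, ∀ c ≥ k, μ + c • P.root i ∉ S)
    {μ₀ : M} {z₀ : ι → ℤ} (hz₀ : ∀ i, P.toLinearMap μ₀ (P.coroot i) = z₀ i) :
    {q | q ∈ AddSubgroup.closure (Set.range P.root) ∧ μ₀ + q ∈ S}.Finite := by
  classical
  -- a coefficient above `m` outweighs the pairing of `μ₀` with the corresponding coroot, and stays
  -- removable when further acute roots are added to the base point
  let m : ℕ := ∑ i, (z₀ i).natAbs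
  have hm (i : ι) : -z₀ i ≤ m := by
    have : (z₀ i).natAbs ≤ m :=
      Finset.single_le_sum (f := fun i => (z₀ i).natAbs) (fun _ _ => Nat.zero_le _)
        (Finset.mem_univ i)
    omega
  let z (a : ι → ℕ) (j : ι) : ℤ := z₀ j + ∑ l, a l * P.pairingIn ℤ l j
  have hz (a : ι → ℕ) (j : ι) :
      P.toLinearMap (μ₀ + ∑ l, a l • P.root l) (P.coroot j) = z a j := by
    have h (l : ι) := P.algebraMap_pairingIn ℤ l j
    simp only [algebraMap_int_eq, eq_intCast] at h
    simp [z, hz₀, h]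
  choose k hk using fun (a : ι → ℕ) (i : ι) => hbd _ i _ (hz a i)
  obtain ⟨K, hK⟩ : ∃ K : ℕ, ∀ a ≤ (fun _ : ι => m), ∀ i, k a i ≤ K := by
    obtain ⟨K, hK⟩ := ((Set.finite_Iic (fun _ : ι => m)).image fun a => ∑ i, k a i).bddAbove
    refine ⟨K, fun a ha i => le_trans ?_ (hK ⟨a, ha, rfl⟩)⟩
    exact Finset.single_le_sum (f := fun i => k a i) (fun _ _ => Nat.zero_le _)
      (Finset.mem_univ i)
  refine ((Set.finite_Iic (fun _ : ι => max K m)).image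
    fun c : ι → ℕ => ∑ i, c i • P.root i).subset ?_
  rintro q ⟨hq, hqS⟩
  obtain ⟨c, rfl, hc⟩ := P.exists_acute_sum hq
  refine ⟨c, fun i => ?_, rfl⟩
  change c i ≤ max K m
  by_contra! hi
  obtain ⟨hiK, him⟩ := max_lt_iff.1 hi
  -- the small coefficients, which stay at the base point
  let a (j : ι) : ℕ := if c j ≤ m then c j else 0
  let T : Finset ι := Finset.univ.filter fun j => j ≠ i ∧ m < c j
  have ham : a ≤ fun _ => m := fun j => by
    simp only [a]
    split_ifs with h
    exacts [h, Nat.zero_le _]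
  have hsplit : μ₀ + ∑ j, c j • P.root j =
      (μ₀ + ∑ j, a j • P.root j + c i • P.root i) + ∑ j ∈ T, c j • P.root j := by
    have h1 : c i • P.root i = ∑ j, if j = i then c j • P.root j else 0 := by simp
    rw [h1, Finset.sum_filter, add_assoc, add_assoc, ← Finset.sum_add_distrib,
      ← Finset.sum_add_distrib]
    congr 1
    refine Finset.sum_congr rfl fun j _ => ?_
    rcases eq_or_ne j i with rfl | hji
    · simp [a, him.not_ge]
    · by_cases hjm : c j ≤ m
      · simp [a, hji, hjm, hjm.not_gt]
      · simp [a, hji, hjm, not_le.1 hjm]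
  refine hk a i (c i) ((hK a ham i).trans hiK.le) <|
    mem_of_add_acute_sum_mem hS hc T (fun j hj => ?_) _ (fun j => z a j + c i * P.pairingIn ℤ i j)
      (fun j => ?_) (fun j hj => ?_) (hsplit ▸ hqS)
  · have := (Finset.mem_filter.1 hj).2.2
    omega
  · have h := P.algebraMap_pairingIn ℤ i j
    simp only [algebraMap_int_eq, eq_intCast] at h
    rw [map_add, LinearMap.add_apply, hz]
    simp [h]
  · have hj' := (Finset.mem_filter.1 hj).2.2
    have h1 : 0 ≤ ∑ l, (a l : ℤ) * P.pairingIn ℤ l j := Finset.sum_nonneg fun l _ => by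
      rcases eq_or_ne (a l) 0 with h0 | h0
      · simp [h0]
      · refine mul_nonneg (Nat.cast_nonneg _) (hc l j (fun h => h0 ?_) (by omega))
        simp [a, h]
    have h2 := mul_nonneg (Nat.cast_nonneg (α := ℤ) (c i)) (hc i j (by omega) (by omega))
    have h3 := hm j
    simp only [z]
    omega

end RootLattice

/-! ### Brackets in the toroidal Lie algebra -/

namespace ToroidalLie

variable {𝔤 : Type*} [LieRing 𝔤] [LieAlgebra ℂ 𝔤] {n : ℕ} {B : InvForm 𝔤}

variable (B) in
/-- The inclusion of `𝔤_A` into `τ`. -/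
noncomputable def loopInl : Loop n 𝔤 →ₗ[ℂ] Toroidal n B where
  toFun x := (x, 0, 0)
  map_add' _ _ := Prod.ext rfl (Prod.ext (add_zero _).symm (add_zero _).symm)
  map_smul' _ _ := Prod.ext rfl (Prod.ext (smul_zero _).symm (smul_zero _).symm)

variable (B) in
/-- The inclusion of `𝒵` into `τ`. -/
noncomputable def centerInl : CenterZ n →ₗ[ℂ] Toroidal n B where
  toFun z := (0, z, 0)
  map_add' _ _ := Prod.ext (add_zero _).symm (Prod.ext rfl (add_zero _).symm)
  map_smul' _ _ := Prod.ext (smul_zero _).symm (Prod.ext rfl (smul_zero _).symm)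

lemma loop_eq_loopInl (X : 𝔤) (f : Laurent n) : loop n B X f = loopInl B (ten n 𝔤 f X) := rfl

lemma loop_lie_loop (X Y : 𝔤) (r s : Fin n → ℤ) :
    ⁅loop n B X (mono r), loop n B Y (mono s)⁆ = loop n B ⁅X, Y⁆ (mono (r + s)) +
      centerInl B (B.form X Y • zmk (r + s) (fun i => (r i : ℂ))) := by
  rw [bracket_def]
  refine Prod.ext ?_ (Prod.ext ?_ ?_)
  · change ⁅ten n 𝔤 (mono r) X, ten n 𝔤 (mono s) Y⁆ + derG n 𝔤 0 _ - derG n 𝔤 0 _ =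
      ten n 𝔤 (mono (r + s)) ⁅X, Y⁆ + 0
    simp only [ten_lie, mono_mul, map_zero, LinearMap.zero_apply, add_zero, sub_zero]
  · change cocycle n B (ten n 𝔤 (mono r) X) (ten n 𝔤 (mono s) Y) + derZ n 0 0 - derZ n 0 0 =
      0 + B.form X Y • zmk (r + s) (fun i => (r i : ℂ))
    simp only [cocycle_ten, omega_mono, map_zero, add_zero, sub_zero, zero_add]
  · change (0 : Fin n → ℂ) = 0 + 0
    simp

lemma loop_one_lie_loop (X Y : 𝔤) (s : Fin n → ℤ) :
    ⁅loop n B X 1, loop n B Y (mono s)⁆ = loop n B ⁅X, Y⁆ (mono s) := by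
  have h0 : (fun i => (((0 : Fin n → ℤ) i : ℤ) : ℂ)) = 0 := by ext; simp
  rw [AddMonoidAlgebra.one_def, loop_lie_loop, h0, map_zero, smul_zero, map_zero, zero_add,
    add_zero]

lemma loop_lie_loop_neg (X Y : 𝔤) (r : Fin n → ℤ) :
    ⁅loop n B X (mono r), loop n B Y (mono (-r))⁆ =
      loop n B ⁅X, Y⁆ 1 + B.form X Y • ∑ i, (r i : ℂ) • tK B 0 i := by
  rw [loop_lie_loop, add_neg_cancel, AddMonoidAlgebra.one_def, map_smul]
  congr 2
  have h : (fun i => (r i : ℂ)) = ∑ i, (r i : ℂ) • (Pi.single i 1 : Fin n → ℂ) := by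
    ext j
    simp [Finset.sum_apply, Pi.single_apply]
  rw [h, map_sum, map_sum]
  simp_rw [map_smul]
  rfl

lemma d_lie_loop (i : Fin n) (X : 𝔤) (m : Fin n → ℤ) :
    ⁅d B i, loop n B X (mono m)⁆ = (m i : ℂ) • loop n B X (mono m) := by
  rw [bracket_def]
  refine Prod.ext ?_ (Prod.ext ?_ ?_)
  · change ⁅(0 : Loop n 𝔤), _⁆ + derG n 𝔤 (Pi.single i 1) (ten n 𝔤 (mono m) X) - derG n 𝔤 0 0 =
      (m i : ℂ) • ten n 𝔤 (mono m) X
    rw [derG_ten, derA_mono, map_smul, LinearMap.smul_apply]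
    simp only [zero_lie, zero_add, map_zero, sub_zero]
    simp only [deg, Pi.single_apply, ite_mul, one_mul, zero_mul, Finset.sum_ite_eq',
      Finset.mem_univ, if_true]
  · change cocycle n B 0 _ + derZ n _ 0 - derZ n 0 0 = (m i : ℂ) • 0
    simp
  · change (0 : Fin n → ℂ) = (m i : ℂ) • 0
    simp

/-! ### Weight spaces indexed by a finite weight and a degree -/

variable (H : LieSubalgebra ℂ 𝔤) (V : Type*) [AddCommGroup V] [Module ℂ V]
  [LieRingModule (Toroidal n B) V] [LieModule ℂ (Toroidal n B) V]

variable (B) in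
/-- The vectors on which `H ⊗ 1` acts through `μ` and each `d_i` acts by `ν i`. When all `K_i` act
by zero, the nonzero ones are the nonzero weight spaces for `h̲`, with a weight recorded by its
restrictions to `H` and to the span of the `d_i`. -/
def bigradedSpace
    (μ : Module.Dual ℂ H) (ν : Fin n → ℂ) : Submodule ℂ V where
  carrier := {v | (∀ X : H, ⁅loop n B (X : 𝔤) 1, v⁆ = μ X • v) ∧ ∀ i, ⁅d B i, v⁆ = ν i • v}
  add_mem' hv hw :=
    ⟨fun X => by rw [lie_add, hv.1, hw.1, smul_add], fun i => by rw [lie_add, hv.2, hw.2, smul_add]⟩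
  zero_mem' := by simp
  smul_mem' c v hv :=
    ⟨fun X => by rw [lie_smul, hv.1, smul_comm], fun i => by rw [lie_smul, hv.2, smul_comm]⟩

variable {H V}

lemma loop_lie_mem_bigradedSpace {α μ : Module.Dual ℂ H} {ν : Fin n → ℂ} {X : 𝔤}
    (hX : ∀ h : H, ⁅(h : 𝔤), X⁆ = α h • X) (m : Fin n → ℤ) {v : V}
    (hv : v ∈ bigradedSpace B H V μ ν) :
    ⁅loop n B X (mono m), v⁆ ∈ bigradedSpace B H V (μ + α) (ν + fun i => (m i : ℂ)) := by
  refine ⟨fun h => ?_, fun i => ?_⟩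
  · have h1 : loop n B (α h • X) (mono m) = α h • loop n B X (mono m) := by
      simp only [loop_eq_loopInl, map_smul]
    rw [leibniz_lie, loop_one_lie_loop, hX, h1, hv.1, smul_lie, lie_smul, LinearMap.add_apply]
    module
  · rw [leibniz_lie, d_lie_loop, hv.2, smul_lie, lie_smul, Pi.add_apply]
    module

lemma toEnd_pow_mem_bigradedSpace {α μ : Module.Dual ℂ H} {ν : Fin n → ℂ} {X : 𝔤}
    (hX : ∀ h : H, ⁅(h : 𝔤), X⁆ = α h • X) (m : Fin n → ℤ) {v : V}
    (hv : v ∈ bigradedSpace B H V μ ν) (k : ℕ) :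
    (LieModule.toEnd ℂ (Toroidal n B) V (loop n B X (mono m)) ^ k) v ∈
      bigradedSpace B H V (μ + k • α) (ν + k • fun i => (m i : ℂ)) := by
  induction k with
  | zero => simpa
  | succ k ih =>
    rw [pow_succ', Module.End.mul_apply, LieModule.toEnd_apply_apply, succ_nsmul, succ_nsmul,
      ← add_assoc, ← add_assoc]
    exact loop_lie_mem_bigradedSpace hX m ih

lemma mem_bigradedSpace_of_mem_weightSpace {χ : Module.Dual ℂ (cartan n B H)} {v : V}
    (hv : v ∈ weightSpace H V χ) :
    ∃ (μ : Module.Dual ℂ H) (ν : Fin n → ℂ), v ∈ bigradedSpace B H V μ ν := by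
  let ι : H →ₗ[ℂ] cartan n B H :=
    { toFun := fun X => ⟨loop n B X 1, Submodule.subset_span (Or.inl (Or.inl ⟨X, X.2, rfl⟩))⟩
      map_add' := fun X Y => Subtype.ext (map_add (loopInl B ∘ₗ ten n 𝔤 1) (X : 𝔤) Y)
      map_smul' := fun c X => Subtype.ext (map_smul (loopInl B ∘ₗ ten n 𝔤 1) c (X : 𝔤)) }
  exact ⟨χ ∘ₗ ι, fun i => χ ⟨d B i, Submodule.subset_span (Or.inr ⟨i, rfl⟩)⟩,
    fun X => hv (ι X), fun i => hv ⟨d B i, _⟩⟩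

/-- When the `K_i` act by zero, a nonzero bigraded space lies in a single weight space. -/
lemma exists_bigradedSpace_le_weightSpace (hK : ∀ (i : Fin n) (v : V), ⁅tK B 0 i, v⁆ = 0)
    {μ : Module.Dual ℂ H} {ν : Fin n → ℂ} (hne : bigradedSpace B H V μ ν ≠ ⊥) :
    ∃ χ : Module.Dual ℂ (cartan n B H), bigradedSpace B H V μ ν ≤ weightSpace H V χ := by
  obtain ⟨v, hv, hv0⟩ := (Submodule.ne_bot_iff _).1 hne
  have hscalar (x : Toroidal n B) (hx : x ∈ cartan n B H) :
      ∃ c : ℂ, ∀ w ∈ bigradedSpace B H V μ ν, ⁅x, w⁆ = c • w := by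
    induction hx using Submodule.span_induction with
    | mem x hx =>
      rcases hx with (⟨X, hX, rfl⟩ | ⟨i, rfl⟩) | ⟨i, rfl⟩
      · exact ⟨μ ⟨X, hX⟩, fun w hw => hw.1 ⟨X, hX⟩⟩
      · exact ⟨0, fun w _ => by rw [hK, zero_smul]⟩
      · exact ⟨ν i, fun w hw => hw.2 i⟩
    | zero => exact ⟨0, by simp⟩
    | add x y _ _ hx hy =>
      obtain ⟨a, ha⟩ := hx
      obtain ⟨b, hb⟩ := hy
      exact ⟨a + b, fun w hw => by rw [add_lie, ha w hw, hb w hw, add_smul]⟩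
    | smul t x _ hx =>
      obtain ⟨a, ha⟩ := hx
      exact ⟨t * a, fun w hw => by rw [smul_lie, ha w hw, mul_smul]⟩
  choose c hc using fun x : cartan n B H => hscalar x x.2
  refine ⟨{ toFun := c, map_add' := fun x y => ?_, map_smul' := fun t x => ?_ },
    fun w hw x => hc x w hw⟩
  · refine smul_left_injective ℂ hv0 ?_
    change c (x + y) • v = (c x + c y) • v
    rw [add_smul, ← hc _ v hv, ← hc _ v hv, ← hc _ v hv]
    exact add_lie (x : Toroidal n B) y v
  · refine smul_left_injective ℂ hv0 ?_
    change c (t • x) • v = (t * c x) • v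
    rw [mul_smul, ← hc _ v hv, ← hc _ v hv]
    exact smul_lie t (x : Toroidal n B) v

lemma finiteDimensional_bigradedSpace (hK : ∀ (i : Fin n) (v : V), ⁅tK B 0 i, v⁆ = 0)
    (hfin : ∀ μ : Module.Dual ℂ (cartan n B H), FiniteDimensional ℂ (weightSpace H V μ))
    (μ : Module.Dual ℂ H) (ν : Fin n → ℂ) : FiniteDimensional ℂ (bigradedSpace B H V μ ν) := by
  by_cases hne : bigradedSpace B H V μ ν = ⊥
  · rw [hne]
    infer_instance
  · obtain ⟨χ, hχ⟩ := exists_bigradedSpace_le_weightSpace hK hne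
    have := hfin χ
    exact Submodule.finiteDimensional_of_le hχ

end ToroidalLie

/-! ### Root strings of weights -/

namespace ToroidalLie

open LieAlgebra LieAlgebra.IsKilling

variable {𝔤 : Type*} [LieRing 𝔤] [LieAlgebra ℂ 𝔤] [FiniteDimensional ℂ 𝔤]
  [LieAlgebra.IsSimple ℂ 𝔤] {H : LieSubalgebra ℂ 𝔤} [H.IsCartanSubalgebra]
  {n : ℕ} {B : InvForm 𝔤} {V : Type*} [AddCommGroup V] [Module ℂ V]
  [LieRingModule (Toroidal n B) V] [LieModule ℂ (Toroidal n B) V]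

lemma exists_root_vectors (i : H.root) :
    ∃ e ∈ rootSpace H i.1, ∃ f ∈ rootSpace H (-i.1), ⁅e, f⁆ = ((coroot i.1 : H) : 𝔤) := by
  have hi : i.1.IsNonZero := H.isNonZero_coe_root i
  obtain ⟨h, e, f, ht, he, hf⟩ := exists_isSl2Triple_of_weight_isNonZero hi
  exact ⟨e, he, f, hf, by rw [ht.lie_e_f, ht.h_eq_coroot hi he hf]⟩

lemma lie_root_vector {i : H.root} {e : 𝔤} (he : e ∈ rootSpace H i.1) (h : H) :
    ⁅(h : 𝔤), e⁆ = (rootSystem H).root i h • e :=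
  lie_eq_smul_of_mem_rootSpace he h

lemma lie_neg_root_vector {i : H.root} {f : 𝔤} (hf : f ∈ rootSpace H (-i.1)) (h : H) :
    ⁅(h : 𝔤), f⁆ = (-(rootSystem H).root i) h • f :=
  lie_eq_smul_of_mem_rootSpace hf h

/-- As the `K_i` act by zero, `e ⊗ t^m` and `f ⊗ t^{-m}` span an `sl₂` with the same Cartan element
for all `m`, and the theory of highest weights for `sl₂` applies to it. -/
lemma exists_highest_of_root_vectors (hint : IsIntegrable n B H V)
    (hK : ∀ (i : Fin n) (v : V), ⁅tK B 0 i, v⁆ = 0) {i : H.root} {e f : 𝔤}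
    (he : e ∈ rootSpace H i.1) (hf : f ∈ rootSpace H (-i.1))
    (hef : ⁅e, f⁆ = ((coroot i.1 : H) : 𝔤)) (m : Fin n → ℤ)
    {μ : Module.Dual ℂ H} {ν : Fin n → ℂ} {v : V} (hv : v ∈ bigradedSpace B H V μ ν)
    (hv0 : v ≠ 0) :
    ∃ k p : ℕ, μ (coroot i.1) + 2 * k = p ∧ ∀ c ≤ p,
      (LieModule.toEnd ℂ (Toroidal n B) V (loop n B e (mono m)) ^ c)
        ((LieModule.toEnd ℂ (Toroidal n B) V (loop n B f (mono (-m))) ^ c)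
          ((LieModule.toEnd ℂ (Toroidal n B) V (loop n B e (mono m)) ^ k) v)) ≠ 0 := by
  have hi : i.1.IsNonZero := H.isNonZero_coe_root i
  have hi' : (-i.1).IsNonZero := by simpa using hi
  have hα : (rootSystem H).root i (coroot i.1) = 2 := root_apply_coroot hi
  refine slTwo_exists_highest
    (D := LieModule.toEnd ℂ (Toroidal n B) V (loop n B ((coroot i.1 : H) : 𝔤) 1))
    (fun x => ?_) (fun x => ?_) (fun x => ?_) (hint.locallyNilpotent _ hi _ he m)
    (hint.locallyNilpotent _ hi' _ hf (-m)) hv0 (hv.1 _)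
  · simp only [LieModule.toEnd_apply_apply]
    have hzero : ⁅B.form e f • ∑ i, (m i : ℂ) • tK B 0 i, x⁆ = 0 := by
      rw [smul_lie, sum_lie]
      simp [hK]
    rw [leibniz_lie, loop_lie_loop_neg, hef, add_lie, hzero, add_zero, add_comm]
  · simp only [LieModule.toEnd_apply_apply]
    rw [leibniz_lie, loop_one_lie_loop, lie_neg_root_vector hf, LinearMap.neg_apply, hα]
    simp only [loop_eq_loopInl, map_smul, smul_lie]
    module
  · simp only [LieModule.toEnd_apply_apply]
    rw [leibniz_lie, loop_one_lie_loop, lie_root_vector he, hα]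
    simp only [loop_eq_loopInl, map_smul, smul_lie]
    module

lemma exists_int_of_bigradedSpace_ne_bot (hint : IsIntegrable n B H V)
    (hK : ∀ (i : Fin n) (v : V), ⁅tK B 0 i, v⁆ = 0)
    {μ : Module.Dual ℂ H} {ν : Fin n → ℂ} (hne : bigradedSpace B H V μ ν ≠ ⊥) (i : H.root) :
    ∃ z : ℤ, μ (coroot i.1) = z := by
  obtain ⟨v, hv, hv0⟩ := (Submodule.ne_bot_iff _).1 hne
  obtain ⟨e, he, f, hf, hef⟩ := exists_root_vectors i
  obtain ⟨k, p, hp, -⟩ := exists_highest_of_root_vectors hint hK he hf hef 0 hv hv0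
  refine ⟨p - 2 * k, ?_⟩
  push_cast
  linear_combination hp

/-- The descent step along root strings. Because `m` is arbitrary, going down by a root `α` may be
combined with any change of degree by a multiple of the number of steps. -/
lemma bigradedSpace_sub_ne_bot (hint : IsIntegrable n B H V)
    (hK : ∀ (i : Fin n) (v : V), ⁅tK B 0 i, v⁆ = 0)
    {μ : Module.Dual ℂ H} {ν : Fin n → ℂ} (hne : bigradedSpace B H V μ ν ≠ ⊥) {i : H.root}
    {z : ℤ} (hz : μ (coroot i.1) = z) {c : ℕ} (hc : c ≤ z) (m : Fin n → ℤ) :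
    bigradedSpace B H V (μ - c • (rootSystem H).root i) (ν - c • fun i => (m i : ℂ)) ≠ ⊥ := by
  obtain ⟨v, hv, hv0⟩ := (Submodule.ne_bot_iff _).1 hne
  obtain ⟨e, he, f, hf, hef⟩ := exists_root_vectors i
  obtain ⟨k, p, hp, hne0⟩ := exists_highest_of_root_vectors hint hK he hf hef m hv hv0
  have hp' : z + 2 * k = p := by
    rw [hz] at hp
    exact_mod_cast hp
  have hmem := toEnd_pow_mem_bigradedSpace (lie_neg_root_vector hf) (-m)
    (toEnd_pow_mem_bigradedSpace (lie_root_vector he) m hv k) (k + c)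
  have h1 : μ - c • (rootSystem H).root i =
      μ + k • (rootSystem H).root i + (k + c) • -(rootSystem H).root i := by
    rw [smul_neg, add_smul]
    abel
  have h2 : ν - c • (fun i => (m i : ℂ)) =
      ν + k • (fun i => (m i : ℂ)) + (k + c) • fun i => (((-m) i : ℤ) : ℂ) := by
    ext j
    simp
    ring
  rw [h1, h2]
  refine (Submodule.ne_bot_iff _).2 ⟨_, hmem, fun h => ?_⟩
  exact hne0 (k + c) (by omega) (by rw [h, map_zero])

/-- A weight `μ + c α` with `c` large would give, inside a finite-dimensional space of weight `μ`, a
vector that `c` applications of a root vector do not kill. -/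
lemma exists_forall_bigradedSpace_add_eq_bot (hint : IsIntegrable n B H V)
    (hK : ∀ (i : Fin n) (v : V), ⁅tK B 0 i, v⁆ = 0)
    (hfin : ∀ μ : Module.Dual ℂ (cartan n B H), FiniteDimensional ℂ (weightSpace H V μ))
    {μ : Module.Dual ℂ H} (ν : Fin n → ℂ) {i : H.root} {z : ℤ} (hz : μ (coroot i.1) = z) :
    ∃ N : ℕ, ∀ c ≥ N, bigradedSpace B H V (μ + c • (rootSystem H).root i) ν = ⊥ := by
  have hi : i.1.IsNonZero := H.isNonZero_coe_root i
  have hα : (rootSystem H).root i (coroot i.1) = 2 := root_apply_coroot hi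
  obtain ⟨e, he, f, hf, hef⟩ := exists_root_vectors i
  have := finiteDimensional_bigradedSpace hK hfin μ ν
  obtain ⟨N, hN⟩ := exists_forall_pow_apply_eq_zero (hint.locallyNilpotent _ hi _ he 0)
    (bigradedSpace B H V μ ν)
  refine ⟨max N z.natAbs, fun c hc => ?_⟩
  obtain ⟨hcN, hcz⟩ := max_le_iff.1 hc
  by_contra hne
  obtain ⟨v, hv, hv0⟩ := (Submodule.ne_bot_iff _).1 hne
  obtain ⟨k, p, hp, hne0⟩ := exists_highest_of_root_vectors hint hK he hf hef 0 hv hv0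
  have hp' : z + 2 * c + 2 * k = p := by
    rw [LinearMap.add_apply, LinearMap.smul_apply, hα, hz, nsmul_eq_mul] at hp
    have : (z : ℂ) + 2 * c + 2 * k = p := by linear_combination hp
    exact_mod_cast this
  refine hne0 (c + k) (by omega) (hN _ (by omega) _ ?_)
  have hmem := toEnd_pow_mem_bigradedSpace (lie_neg_root_vector hf) (-0)
    (toEnd_pow_mem_bigradedSpace (lie_root_vector he) 0 hv k) (c + k)
  have h1 : μ = μ + c • (rootSystem H).root i + k • (rootSystem H).root i +
      (c + k) • -(rootSystem H).root i := by
    rw [smul_neg, add_smul]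
    abel
  have h2 : ν = ν + k • (fun i => (((0 : Fin n → ℤ) i : ℤ) : ℂ)) +
      (c + k) • fun i => (((-0 : Fin n → ℤ) i : ℤ) : ℂ) := by
    ext j
    simp
  rw [← h1, ← h2] at hmem
  exact hmem

/-! ### Finiteness of the set of finite weights -/

lemma finite_weights_of_degree (hint : IsIntegrable n B H V)
    (hK : ∀ (i : Fin n) (v : V), ⁅tK B 0 i, v⁆ = 0)
    (hfin : ∀ μ : Module.Dual ℂ (cartan n B H), FiniteDimensional ℂ (weightSpace H V μ))
    {μ₀ : Module.Dual ℂ H} {ν₀ : Fin n → ℂ} (hne : bigradedSpace B H V μ₀ ν₀ ≠ ⊥) :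
    {q | q ∈ AddSubgroup.closure (Set.range (rootSystem H).root) ∧
      bigradedSpace B H V (μ₀ + q) ν₀ ≠ ⊥}.Finite := by
  choose z₀ hz₀ using exists_int_of_bigradedSpace_ne_bot hint hK hne
  refine finite_of_string_descent (P := rootSystem H)
    (S := {μ | bigradedSpace B H V μ ν₀ ≠ ⊥}) (fun μ i z c hz hzc hmem => ?_)
    (fun μ i z hz => ?_) (μ₀ := μ₀) (z₀ := z₀) hz₀
  · have hi : i.1.IsNonZero := H.isNonZero_coe_root i
    have hα : (rootSystem H).root i (coroot i.1) = 2 := root_apply_coroot hi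
    have hz' : (μ + c • (rootSystem H).root i) (coroot i.1) = ((z + 2 * c : ℤ) : ℂ) := by
      have hz1 : μ (coroot i.1) = z := hz
      rw [LinearMap.add_apply, LinearMap.smul_apply, hα, hz1, nsmul_eq_mul]
      push_cast
      ring
    have h := bigradedSpace_sub_ne_bot hint hK hmem hz' (c := c) (by omega) 0
    have h2 : ν₀ - c • (fun i => (((0 : Fin n → ℤ) i : ℤ) : ℂ)) = ν₀ := by
      ext j
      simp
    rwa [add_sub_cancel_right, h2] at h
  · obtain ⟨N, hN⟩ := exists_forall_bigradedSpace_add_eq_bot hint hK hfin ν₀ (μ := μ) hz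
    exact ⟨N, fun c hc hmem => hmem (hN c hc)⟩

/-- Up to the zero weight, any weight can be lowered by some root to one of any other degree
in the same coset, so it is enough to bound the weights of a single degree. -/
lemma finite_weights (hint : IsIntegrable n B H V)
    (hK : ∀ (i : Fin n) (v : V), ⁅tK B 0 i, v⁆ = 0)
    (hfin : ∀ μ : Module.Dual ℂ (cartan n B H), FiniteDimensional ℂ (weightSpace H V μ))
    {μ₀ : Module.Dual ℂ H} {ν₀ : Fin n → ℂ} (hne : bigradedSpace B H V μ₀ ν₀ ≠ ⊥) :
    {q | q ∈ AddSubgroup.closure (Set.range (rootSystem H).root) ∧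
      ∃ m : Fin n → ℤ, bigradedSpace B H V (μ₀ + q) (ν₀ + fun i => (m i : ℂ)) ≠ ⊥}.Finite := by
  refine ((Set.finite_singleton (-μ₀)).union <| Set.finite_iUnion fun i : H.root =>
    (finite_weights_of_degree hint hK hfin hne).image (· + (rootSystem H).root i)).subset ?_
  rintro q ⟨hq, m, hm⟩
  choose z hz using exists_int_of_bigradedSpace_ne_bot hint hK hm
  by_cases hall : ∀ i, z i = 0
  · left
    have h0 : μ₀ + q = 0 := by
      refine LinearMap.ext_on_range (RootPairing.IsRootSystem.span_coroot_eq_top (P := rootSystem H))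
        fun i => ?_
      rw [rootSystem_coroot_apply, hz, hall, Int.cast_zero, LinearMap.zero_apply]
    exact eq_neg_of_add_eq_zero_right h0
  · right
    push Not at hall
    -- if the value at the coroot of `i` is negative, use the opposite root
    obtain ⟨i, hi⟩ : ∃ i, 1 ≤ z i := by
      obtain ⟨i, hi⟩ := hall
      rcases lt_or_gt_of_ne hi with h | h
      · refine ⟨(rootSystem H).reflectionPerm i i, ?_⟩
        have h1 := hz ((rootSystem H).reflectionPerm i i)
        rw [← rootSystem_coroot_apply, RootPairing.coroot_reflectionPerm,
          RootPairing.coreflection_apply_self, map_neg, rootSystem_coroot_apply, hz] at h1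
        have h2 : -z i = z ((rootSystem H).reflectionPerm i i) := by exact_mod_cast h1
        omega
      · exact ⟨i, h⟩
    refine Set.mem_iUnion.2 ⟨i, q - (rootSystem H).root i, ⟨?_, ?_⟩, sub_add_cancel _ _⟩
    · exact sub_mem hq (AddSubgroup.subset_closure ⟨i, rfl⟩)
    · have h := bigradedSpace_sub_ne_bot hint hK hm (hz i) (c := 1) (by exact_mod_cast hi) m
      rwa [one_smul, one_smul, add_sub_cancel_right, add_sub_assoc] at h

/-- The linear extension of the height function of a base. -/
lemma exists_linear_height (b : (rootSystem H).Base) :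
    ∃ φ : Module.Dual ℂ H →ₗ[ℂ] ℂ, ∀ i, φ ((rootSystem H).root i) = b.height i := by
  let φ : Module.Dual ℂ H →ₗ[ℂ] ℂ := b.toWeightBasis.constr ℂ fun _ => (1 : ℂ)
  have hφ (j : H.root) (hj : j ∈ b.support) : φ ((rootSystem H).root j) = 1 := by
    rw [← b.toWeightBasis_apply ⟨j, hj⟩, Module.Basis.constr_basis]
  refine ⟨φ, fun i => ?_⟩
  obtain ⟨g, -, -, hg⟩ := b.exists_root_eq_sum_int i
  rw [RootPairing.Base.height_eq_sum hg, hg, map_sum, Int.cast_sum]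
  refine Finset.sum_congr rfl fun j hj => ?_
  rw [map_zsmul, hφ j hj, zsmul_one]

/-- Annihilation by `n⁺ ⊗ A` can be tested on the elements `X_α ⊗ t^m`. -/
lemma nPos_loop_lie_eq_zero {b : (rootSystem H).Base} {v : V}
    (h : ∀ i, b.IsPos i → ∀ X ∈ rootSpace H i.1, ∀ m : Fin n → ℤ, ⁅loop n B X (mono m), v⁆ = 0)
    {X : 𝔤} (hX : X ∈ nPos b) (f : Laurent n) : ⁅loop n B X f, v⁆ = 0 := by
  have hmono (m : Fin n → ℤ) : ⁅loop n B X (mono m), v⁆ = 0 := by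
    have hle : nPos b ≤ LinearMap.ker (LinearMap.applyₗ v ∘ₗ
        (LieModule.toEnd ℂ (Toroidal n B) V : Toroidal n B →ₗ[ℂ] Module.End ℂ V) ∘ₗ
          loopInl B ∘ₗ ten n 𝔤 (mono m)) :=
      iSup_le fun i Y hY => h i.1 i.2 Y hY m
    exact hle hX
  induction f using AddMonoidAlgebra.induction_linear with
  | zero => simp [loop_eq_loopInl]
  | add f g hf hg =>
    simp only [loop_eq_loopInl, map_add, LinearMap.add_apply, add_lie] at hf hg ⊢
    rw [hf, hg, add_zero]
  | single m c =>
    have hc : (AddMonoidAlgebra.single m c : Laurent n) = c • mono m := by simp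
    simp only [loop_eq_loopInl] at hmono ⊢
    rw [hc, map_smul, LinearMap.smul_apply, map_smul, smul_lie, hmono, smul_zero]

end ToroidalLie

theorem mainTheorem6 {𝔤 : Type*} [LieRing 𝔤] [LieAlgebra ℂ 𝔤] [FiniteDimensional ℂ 𝔤]
    [LieAlgebra.IsSimple ℂ 𝔤] (H : LieSubalgebra ℂ 𝔤) [H.IsCartanSubalgebra]
    (b : (LieAlgebra.IsKilling.rootSystem H).Base) (B : ToroidalLie.InvForm 𝔤)
    (n : ℕ) (hn : 2 ≤ n) (V : Type*) [AddCommGroup V] [Module ℂ V]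
    [LieRingModule (ToroidalLie.Toroidal n B) V] [LieModule ℂ (ToroidalLie.Toroidal n B) V]
    (hirr : LieModule.IsIrreducible ℂ (ToroidalLie.Toroidal n B) V)
    (hint : ToroidalLie.IsIntegrable n B H V)
    (hfin : ∀ μ : Module.Dual ℂ (ToroidalLie.cartan n B H),
      FiniteDimensional ℂ (ToroidalLie.weightSpace H V μ))
    (hK : ∀ (i : Fin n) (v : V), ⁅ToroidalLie.tK B 0 i, v⁆ = 0) :
    ∃ (μ : Module.Dual ℂ (ToroidalLie.cartan n B H)), ∃ v ∈ ToroidalLie.weightSpace H V μ, v ≠ 0 ∧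
      ((∀ X ∈ ToroidalLie.nPos b, ∀ f : ToroidalLie.Laurent n,
          ⁅ToroidalLie.loop n B X f, v⁆ = 0) ∨
        (∀ X ∈ ToroidalLie.nNeg b, ∀ f : ToroidalLie.Laurent n,
          ⁅ToroidalLie.loop n B X f, v⁆ = 0)) := by
  have hnt : Nontrivial V := LieModule.nontrivial_of_isIrreducible ℂ (ToroidalLie.Toroidal n B) V
  obtain ⟨χ₀, hχ₀⟩ : ∃ χ, ToroidalLie.weightSpace (n := n) (B := B) H V χ ≠ ⊥ := by
    by_contra! h
    have := hint.iSup_weightSpace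
    simp only [h, iSup_bot] at this
    exact bot_ne_top this
  obtain ⟨v₀, hv₀, hv₀'⟩ := (Submodule.ne_bot_iff _).1 hχ₀
  obtain ⟨μ₀, ν₀, hmem⟩ := ToroidalLie.mem_bigradedSpace_of_mem_weightSpace hv₀
  have hne : ToroidalLie.bigradedSpace B H V μ₀ ν₀ ≠ ⊥ :=
    (Submodule.ne_bot_iff _).2 ⟨v₀, hmem, hv₀'⟩
  obtain ⟨φ, hφ⟩ := ToroidalLie.exists_linear_height b
  obtain ⟨q, ⟨hq, m, hm⟩, hmax⟩ := Set.exists_max_image _ (fun q => (φ q).re)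
    (ToroidalLie.finite_weights hint hK hfin hne)
    ⟨0, zero_mem _, 0, by simpa [← Pi.zero_def] using hne⟩
  obtain ⟨v, hv, hv0⟩ := (Submodule.ne_bot_iff _).1 hm
  obtain ⟨χ, hχ⟩ := ToroidalLie.exists_bigradedSpace_le_weightSpace hK hm
  refine ⟨χ, v, hχ hv, hv0, Or.inl fun X hX f =>
    ToroidalLie.nPos_loop_lie_eq_zero (fun i hi Y hY r => ?_) hX f⟩
  -- otherwise `q + α_i` is an admissible weight of greater height
  by_contra hYv
  have hmem' := ToroidalLie.loop_lie_mem_bigradedSpace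
    (ToroidalLie.lie_root_vector hY) r hv
  have hle := hmax (q + (LieAlgebra.IsKilling.rootSystem H).root i)
    ⟨add_mem hq (AddSubgroup.subset_closure ⟨i, rfl⟩), m + r,
      (Submodule.ne_bot_iff _).2 ⟨_, ?_, hYv⟩⟩
  · rw [map_add, hφ, Complex.add_re, Complex.intCast_re] at hle
    have : (0 : ℝ) < b.height i := by exact_mod_cast b.isPos_iff.1 hi
    linarith
  · convert hmem' using 1
    rw [add_assoc, add_assoc]
    congr 2
    ext j
    simp
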